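/- For integers $k\ge 1$ and $n\ge 0$, let $A(n,k)$ be the real $n\times n$ skew-symmetric Toeplitz matrix whose first $k$ superdiagonals have all entries $1$ and whose remaining superdiagonals have all entries $0$; that is, its $(i,j)$ entry is $1$ if $1\le j-i\le k$, is $-1$ if $1\le i-j\le k$, and is $0$ otherwise (the empty matrix $A(0,k)$ counts as nonsingular). Let $$P_0(k)=\frac{\#\{\,n\in\mathbb{Z} : 0\le n<k^2+k,\ A(n,k)\text{ is nonsingular}\,\}}{k^2+k}.$$ Then $P_0(k)\to 3/\pi^2$ as $k\to\infty$, where $3/\pi^2\approx 30.4\%$, that is, $|3/\pi^2-0.304|<0.0005$. -/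

import Mathlib

/-- The skew-symmetric Toeplitz band matrix `A(n, k)`: the real `n × n` matrix whose first `k`
superdiagonals have all entries `1`, whose first `k` subdiagonals have all entries `-1`, and whose
other entries are `0`. -/
def skewBandMatrix (n k : ℕ) : Matrix (Fin n) (Fin n) ℝ :=
  Matrix.of fun i j =>
    if (i : ℕ) < j ∧ (j : ℕ) ≤ i + k then 1
    else if (j : ℕ) < i ∧ (i : ℕ) ≤ j + k then -1
    else 0

/-- `P₀(k)`, as a fraction of `1`: the proportion of the integers `n` with `0 ≤ n < k ^ 2 + k`
for which `A(n, k)` is nonsingular. -/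
noncomputable def nonsingularProportion (k : ℕ) : ℝ :=
  (((Finset.range (k ^ 2 + k)).filter fun n => (skewBandMatrix n k).det ≠ 0).card : ℝ) /
    ((k : ℝ) ^ 2 + k)

/-! Let S_i be the partial sums of a vector, zero before index 0 and constant from n on. The vector
lies in the kernel of A(n,k) iff the windows W_i = S_i - S_{i-k} have period k + 1; equivalently,
the windows of length k + 1 have period k. So W is a function f on Z/(k+1), and the conditions at
the two ends say exactly that f(0) = 0 and that f is constant on the cycles of a permutation,
`bandStep`, depending only on n mod k and n mod k + 1. Hence A(n,k) is nonsingular iff `bandStep` is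
a single cycle (`det_skewBandMatrix_ne_zero_iff`), and by the Chinese remainder theorem it remains
to count pairs (r, s) giving a full cycle.

Relabel the points along such a cycle: `bandStep` becomes i ↦ i - 1, and translation by 1 becomes
some map T. Being a three-block exchange is a statement about the failure to commute with
translation, and it is symmetric in the two maps (`reversesBlocksAt_labelling_iff`). So T is itself
a three-block exchange, with parameters (u, w). It is the first-return map of the rotation by u on
Z/(u+w), hence a full cycle iff u and w are coprime (`exists_isExchangeLabelling_iff`).

The count is therefore the number of coprime pairs u, w ≤ k with u + w > k, which is φ(1) + ... +
φ(k) (`card_coprime_pairs_eq_sum_totient`), asymptotic to 3k²/π². -/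

/-! ### Kernel vectors, window sums and the permutation `bandStep` -/

/-- The sum of the first `i` terms of a vector, extended by zero. -/
noncomputable def partialSum {n : ℕ} (x : Fin n → ℝ) (i : ℕ) : ℝ :=
  ∑ j : Fin n, if (j : ℕ) < i then x j else 0

theorem partialSum_succ {n : ℕ} (x : Fin n → ℝ) {i : ℕ} (hi : i < n) :
    partialSum x (i + 1) = partialSum x i + x ⟨i, hi⟩ := by
  have : x ⟨i, hi⟩ = ∑ j : Fin n, if j = ⟨i, hi⟩ then x j else 0 := by simp
  rw [this, partialSum, partialSum, ← Finset.sum_add_distrib]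
  refine Finset.sum_congr rfl fun j _ => ?_
  rcases lt_trichotomy (j : ℕ) i with h | h | h
  · simp [h, Nat.lt_succ_of_lt h, Fin.ext_iff, h.ne]
  · simp [h, Fin.ext_iff]
  · simp [show ¬ (j : ℕ) < i + 1 by omega, show ¬ (j : ℕ) < i by omega, Fin.ext_iff, h.ne']

theorem partialSum_of_le {n : ℕ} (x : Fin n → ℝ) {i : ℕ} (hi : n ≤ i) :
    partialSum x i = partialSum x n := by
  refine Finset.sum_congr rfl fun j _ => ?_
  simp [j.2, j.2.trans_le hi]

/-- Truncated subtraction is intended: for i < k the lower window starts at 0, where the partial sum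
is 0. At the other end, `partialSum` is constant beyond n. -/
theorem skewBandMatrix_mulVec (n k : ℕ) (x : Fin n → ℝ) (i : Fin n) :
    (skewBandMatrix n k).mulVec x i =
      (partialSum x (i + k + 1) - partialSum x (i + 1)) - (partialSum x i - partialSum x (i - k)) := by
  simp only [Matrix.mulVec, dotProduct, partialSum, skewBandMatrix, Matrix.of_apply,
    ← Finset.sum_sub_distrib]
  refine Finset.sum_congr rfl fun j _ => ?_
  split_ifs <;> first | omega | simp

/-- The permutation of `ZMod (k + 1)` that fixes `0` and rotates `1, …, k` by `-r`, followed by the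
rotation by `s - 1`. -/
def bandStep (k r : ℕ) (s x : ZMod (k + 1)) : ZMod (k + 1) :=
  if x = 0 then s - 1 else if x.val ≤ r then x + s - r - 2 else x + s - r - 1

theorem natCast_succ_self (k : ℕ) : (k : ZMod (k + 1)) = -1 := by
  have := ZMod.natCast_self (k + 1)
  push_cast at this
  exact eq_neg_of_add_eq_zero_left this

theorem bandStep_of_le {k r : ℕ} (s : ZMod (k + 1)) {y : ℕ} (h0 : 0 < y) (hyk : y ≤ k)
    (hy : y ≤ r) : bandStep k r s y = y + s - r - 2 := by
  have hv : ((y : ℕ) : ZMod (k + 1)).val = y := ZMod.val_cast_of_lt (by omega)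
  have : ((y : ℕ) : ZMod (k + 1)) ≠ 0 := by
    intro h; rw [h, ZMod.val_zero] at hv; omega
  rw [bandStep, if_neg this, hv, if_pos hy]

theorem bandStep_of_lt {k r : ℕ} (s : ZMod (k + 1)) {y : ℕ} (hyk : y ≤ k)
    (hy : r < y) : bandStep k r s y = y + s - r - 1 := by
  have hv : ((y : ℕ) : ZMod (k + 1)).val = y := ZMod.val_cast_of_lt (by omega)
  have : ((y : ℕ) : ZMod (k + 1)) ≠ 0 := by
    intro h; rw [h, ZMod.val_zero] at hv; omega
  rw [bandStep, if_neg this, hv, if_neg (by omega)]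

/-- As j runs over 0, …, k - 1, the arguments run over all nonzero residues, so this and the value
at 0 describe `bandStep` completely. -/
theorem bandStep_mod_add_one {k : ℕ} (n : ℕ) {j : ℕ} (hj : j < k) :
    bandStep k (n % k) n (((n + j) % k + 1 : ℕ) : ZMod (k + 1)) = (n + j : ℕ) := by
  have hr : n % k < k := Nat.mod_lt _ (by omega)
  have hm : (n + j) % k = if n % k + j < k then n % k + j else n % k + j - k := by
    rw [Nat.add_mod, Nat.mod_eq_of_lt hj]
    split_ifs with h
    · exact Nat.mod_eq_of_lt h
    · rw [Nat.mod_eq_sub_mod (by omega), Nat.mod_eq_of_lt (by omega)]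
  have hk := natCast_succ_self k
  rw [hm]
  split_ifs with h
  · rw [bandStep_of_lt _ (by omega) (by omega)]
    push_cast
    ring
  · rw [bandStep_of_le _ (by omega) (by omega) (by omega)]
    have e : ((n % k + j - k + 1 : ℕ) : ZMod (k + 1)) = (n % k : ℕ) + j + 2 := by
      rw [Nat.cast_add, Nat.cast_sub (by omega), hk]
      push_cast
      ring
    rw [e]
    push_cast
    ring

theorem bandStep_zero (k r : ℕ) (s : ZMod (k + 1)) : bandStep k r s 0 = s - 1 := by
  simp [bandStep]

theorem bandStep_invariant_iff {k n : ℕ} (hk : 0 < k) (f : ZMod (k + 1) → ℝ) :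
    (∀ x, f (bandStep k (n % k) n x) = f x) ↔
      f (n + k : ℕ) = f 0 ∧ ∀ i, n ≤ i → i < n + k → f (i % k + 1 : ℕ) = f (i : ℕ) := by
  constructor
  · intro h
    refine ⟨?_, fun i h1 h2 => ?_⟩
    · rw [← h 0, bandStep_zero, Nat.cast_add, natCast_succ_self, sub_eq_add_neg]
    · obtain ⟨j, rfl⟩ := Nat.exists_eq_add_of_le h1
      rw [← bandStep_mod_add_one n (by omega : j < k), h]
  · rintro ⟨h0, h⟩ x
    by_cases hx : x = 0
    · rw [hx, ← h0, bandStep_zero, Nat.cast_add, natCast_succ_self, sub_eq_add_neg]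
    · have hx1 : 0 < x.val := Nat.pos_of_ne_zero fun e => hx ((ZMod.val_eq_zero x).1 e)
      have hx2 : x.val < k + 1 := ZMod.val_lt x
      set r := n % k with hr
      have hrk : r < k := Nat.mod_lt _ hk
      obtain ⟨j, hj, hjx⟩ : ∃ j < k, (n + j) % k + 1 = x.val := by
        by_cases hc : r ≤ x.val - 1
        · refine ⟨x.val - 1 - r, by omega, ?_⟩
          rw [Nat.add_mod, ← hr, Nat.mod_eq_of_lt (a := x.val - 1 - r) (by omega),
            Nat.mod_eq_of_lt (by omega)]
          omega
        · refine ⟨x.val - 1 + k - r, by omega, ?_⟩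
          rw [Nat.add_mod, ← hr, Nat.mod_eq_of_lt (a := x.val - 1 + k - r) (by omega),
            Nat.mod_eq_sub_mod (by omega), Nat.mod_eq_of_lt (by omega)]
          omega
      have e : x = ((n + j) % k + 1 : ℕ) := by rw [hjx]; simp
      rw [e, bandStep_mod_add_one n hj, h _ (by omega) (by omega)]

/-- Kernel vectors x correspond to invariant functions f vanishing at 0: f(i) is the window of
length k ending before index i, f(i % k + 1) is the window of length k + 1 ending at i, and x_i is
their difference. -/
theorem det_skewBandMatrix_ne_zero_iff {k : ℕ} (n : ℕ) (hk : 0 < k) :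
    (skewBandMatrix n k).det ≠ 0 ↔ ∀ f : ZMod (k + 1) → ℝ, f 0 = 0 →
      (∀ x, f (bandStep k (n % k) n x) = f x) → ∀ x, f x = 0 := by
  rw [Ne, ← Matrix.exists_mulVec_eq_zero_iff]
  simp only [bandStep_invariant_iff hk]
  have periodic : ∀ (f : ZMod (k + 1) → ℝ) (i : ℕ), f (i + (k + 1) : ℕ) = f (i : ℕ) := by
    intro f i
    rw [Nat.cast_add, ZMod.natCast_self, add_zero]
  constructor
  · intro H f f0 ⟨h1, h2⟩
    by_contra! hne
    refine H ⟨fun i => f ((i : ℕ) % k + 1 : ℕ) - f (i : ℕ), ?_, ?_⟩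
    all_goals
      set x : Fin n → ℝ := fun i => f ((i : ℕ) % k + 1 : ℕ) - f (i : ℕ) with hx
      have step : ∀ i < n + k, partialSum x (i + 1) = partialSum x i +
          (f (i % k + 1 : ℕ) - f (i : ℕ)) := by
        intro i hi
        by_cases hin : i < n
        · rw [partialSum_succ x hin]
        · rw [h2 i (by omega) hi, partialSum_of_le x (by omega : n ≤ i),
            partialSum_of_le x (by omega : n ≤ i + 1)]
          ring
      -- Recovers f as the window sums of x, up to i = n + k; periodicity of f then gives the kernel
      -- equation.
      have win : ∀ i ≤ n + k, partialSum x i - partialSum x (i - k) = f (i : ℕ) := by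
        intro i
        induction i with
        | zero => intro _; simp [f0]
        | succ i ih =>
          intro hi
          have ih := ih (by omega)
          by_cases hik : i < k
          · rw [step i (by omega), Nat.mod_eq_of_lt hik]
            rw [show i - k = 0 by omega] at ih
            rw [show i + 1 - k = 0 by omega]
            linarith
          · obtain ⟨j, rfl⟩ := Nat.exists_eq_add_of_le' (not_lt.1 hik)
            have e := periodic f j
            rw [show j + (k + 1) = j + k + 1 by ring] at e
            have s1 := step (j + k) (by omega)
            have s2 := step j (by omega)
            rw [Nat.add_mod_right] at s1
            rw [Nat.add_sub_cancel] at ih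
            rw [show j + k + 1 - k = j + 1 by omega]
            linarith
    · intro hx0
      obtain ⟨y, hy⟩ := hne
      apply hy
      have h0 : ∀ i, partialSum x i = 0 := by simp [partialSum, hx0]
      have := win y.val (by have := ZMod.val_lt y; omega)
      rw [h0, h0] at this
      simpa using this.symm
    · funext i
      rw [skewBandMatrix_mulVec, win i (by omega)]
      have := win (i + k + 1) (by omega)
      rw [show (i : ℕ) + k + 1 - k = i + 1 by omega] at this
      rw [this, show (i : ℕ) + k + 1 = i + (k + 1) by ring, periodic f i]
      simp
  · rintro H ⟨x, hx, hx0⟩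
    have hA : ∀ i < n, partialSum x (i + k + 1) - partialSum x (i + 1) =
        partialSum x i - partialSum x (i - k) := by
      intro i hi
      have := congrFun hx0 ⟨i, hi⟩
      rw [skewBandMatrix_mulVec] at this
      exact sub_eq_zero.1 this
    set f : ZMod (k + 1) → ℝ := fun y => partialSum x y.val - partialSum x (y.val - k) with hf
    have fi : ∀ i ≤ n + k, f (i : ℕ) = partialSum x i - partialSum x (i - k) := by
      intro i
      induction i using Nat.strong_induction_on with
      | _ i ih =>
        intro hi
        by_cases hik : i < k + 1
        · simp only [hf]
          rw [ZMod.val_cast_of_lt hik]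
        · obtain ⟨j, rfl⟩ := Nat.exists_eq_add_of_le' (not_lt.1 hik)
          rw [periodic f j, ih j (by omega) (by omega), ← hA j (by omega),
            show j + (k + 1) - k = j + 1 by omega, add_assoc]
    -- The longer windows have period k; for i < k they are cut off at 0 and coincide with the
    -- shorter window at i + 1.
    have wi : ∀ i < n + k, f (i % k + 1 : ℕ) = partialSum x (i + 1) - partialSum x (i - k) := by
      intro i
      induction i using Nat.strong_induction_on with
      | _ i ih =>
        intro hi
        by_cases hik : i < k
        · rw [Nat.mod_eq_of_lt hik, fi _ (by omega), show i - k = i + 1 - k by omega]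
        · obtain ⟨j, rfl⟩ := Nat.exists_eq_add_of_le' (not_lt.1 hik)
          rw [Nat.add_mod_right, ih j (by omega) (by omega), Nat.add_sub_cancel]
          linarith [hA j (by omega)]
    have f0 : f 0 = 0 := by
      have := fi 0 (by omega)
      simpa using this
    have hz := H f f0 ⟨?_, ?_⟩
    · apply hx
      funext ⟨i, hi⟩
      have h1 := fi i (by omega)
      have h2 := wi i (by omega)
      rw [hz] at h1 h2
      have := partialSum_succ x hi
      simp only [Pi.zero_apply]
      linarith
    · rw [f0, fi _ le_rfl, Nat.add_sub_cancel, partialSum_of_le x (by omega), sub_self]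
    · intro i h1 h2
      rw [wi i h2, fi i h2.le, partialSum_of_le x h1, partialSum_of_le x (by omega : n ≤ i + 1)]

/-! ### Full cycles as relabellings -/

/-- A self-map `p` of `ZMod m` is a full cycle exactly when there is a relabelling of `ZMod m`,
fixing `0`, that turns `x ↦ x + 1` into `p`. -/
theorem transitive_iff_exists_labelling {m : ℕ} [NeZero m] (p : Equiv.Perm (ZMod m)) :
    (∀ f : ZMod m → ℝ, f 0 = 0 → (∀ x, f (p x) = f x) → ∀ x, f x = 0) ↔
      ∃ L : Equiv.Perm (ZMod m), L 0 = 0 ∧ ∀ i, L (i + 1) = p (L i) := by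
  constructor
  · intro H
    classical
    have hc : ∀ x, p.SameCycle 0 x := by
      intro x
      -- The indicator of the complement of the cycle of 0 is invariant and vanishes at 0.
      have := H (fun x => if p.SameCycle 0 x then 0 else 1)
        (by simp [Equiv.Perm.SameCycle.refl]) (by simp) x
      by_contra hx
      simp [hx] at this
    have hon : p.IsCycleOn ((Finset.univ : Finset (ZMod m)) : Set (ZMod m)) :=
      ⟨by simp, fun x _ y _ => (hc x).symm.trans (hc y)⟩
    have key : ∀ a b : ℕ, (p ^ a) 0 = (p ^ b) 0 ↔ a ≡ b [MOD m] := by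
      intro a b
      rw [hon.pow_apply_eq_pow_apply (Finset.mem_univ _), Finset.card_univ, ZMod.card]
    have inj : Function.Injective fun i : ZMod m => (p ^ i.val) 0 := by
      intro i j hij
      have := (key _ _).1 hij
      rw [← ZMod.natCast_eq_natCast_iff] at this
      simpa using this
    refine ⟨Equiv.ofBijective _ (Finite.injective_iff_bijective.1 inj), by simp, fun i => ?_⟩
    simp only [Equiv.ofBijective_apply]
    rw [← Equiv.Perm.mul_apply, ← pow_succ', key, ← ZMod.natCast_eq_natCast_iff]
    simp
  · rintro ⟨L, L0, hL⟩ f f0 hf x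
    have h : ∀ j : ℕ, f (L j) = 0 := by
      intro j
      induction j with
      | zero => simpa [L0] using f0
      | succ j ih => rw [Nat.cast_succ, hL, hf, ih]
    have := h (L.symm x).val
    simpa using this

theorem bandStep_injective {k r : ℕ} (hr : r < k) (s : ZMod (k + 1)) :
    Function.Injective (bandStep k r s) := by
  have nz : ∀ a : ℕ, a ≠ 0 → a ≤ k → (a : ZMod (k + 1)) ≠ 0 := by
    intro a h0 ha h
    rw [ZMod.natCast_eq_zero_iff] at h
    exact absurd (Nat.le_of_dvd (Nat.pos_of_ne_zero h0) h) (by omega)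
  have hk := natCast_succ_self k
  have key : ∀ a b : ℕ, a ≤ k → b ≤ k → a < b → bandStep k r s a ≠ bandStep k r s b := by
    intro a b ha hb hab h
    rcases Nat.eq_zero_or_pos a with rfl | h0
    · rw [Nat.cast_zero, bandStep_zero] at h
      rcases le_or_gt b r with hbr | hbr
      · rw [bandStep_of_le s hab hb hbr] at h
        refine nz (r - b + 1) (by omega) (by omega) ?_
        rw [Nat.cast_add, Nat.cast_sub hbr]
        linear_combination h
      · rw [bandStep_of_lt s hb hbr] at h
        refine nz (b - r) (by omega) (by omega) ?_
        rw [Nat.cast_sub hbr.le]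
        linear_combination -h
    · rcases le_or_gt b r with hbr | hbr
      · rw [bandStep_of_le s h0 ha (by omega), bandStep_of_le s (by omega) hb hbr] at h
        refine nz (b - a) (by omega) (by omega) ?_
        rw [Nat.cast_sub hab.le]
        linear_combination -h
      · rw [bandStep_of_lt s hb hbr] at h
        rcases le_or_gt a r with har | har
        · rw [bandStep_of_le s h0 ha har] at h
          refine nz (k - (b - a)) (by omega) (by omega) ?_
          rw [Nat.cast_sub (by omega), Nat.cast_sub hab.le, hk]
          linear_combination h
        · rw [bandStep_of_lt s ha har] at h
          refine nz (b - a) (by omega) (by omega) ?_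
          rw [Nat.cast_sub hab.le]
          linear_combination -h
  intro x y h
  by_contra hxy
  have hv : x.val ≠ y.val := fun e => hxy (ZMod.val_injective _ e)
  have hx := ZMod.val_lt x
  have hy := ZMod.val_lt y
  rcases lt_or_gt_of_ne hv with hlt | hlt
  · exact key x.val y.val (by omega) (by omega) hlt (by simpa using h)
  · exact key y.val x.val (by omega) (by omega) hlt (by simpa using h.symm)

/-- A labelling of `ZMod (k + 1)`, fixing `0`, in which `bandStep k r s` becomes `x ↦ x - 1`. -/
def IsBandLabelling (k r : ℕ) (s : ZMod (k + 1)) (L : Equiv.Perm (ZMod (k + 1))) : Prop :=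
  L 0 = 0 ∧ ∀ i, bandStep k r s (L (i + 1)) = L i

theorem det_skewBandMatrix_ne_zero_iff_exists_labelling {k : ℕ} (n : ℕ) (hk : 0 < k) :
    (skewBandMatrix n k).det ≠ 0 ↔ ∃ L, IsBandLabelling k (n % k) n L := by
  rw [det_skewBandMatrix_ne_zero_iff n hk]
  let g : Equiv.Perm (ZMod (k + 1)) := Equiv.ofBijective _
    (Finite.injective_iff_bijective.1 (bandStep_injective (Nat.mod_lt n hk) n))
  have hg : ∀ x, g x = bandStep k (n % k) n x := fun x => rfl
  -- The inverse is used because a band labelling runs against `bandStep`; invariance is the same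
  -- for both.
  have h1 := transitive_iff_exists_labelling g⁻¹
  have h2 : ∀ f : ZMod (k + 1) → ℝ, (∀ x, f (g⁻¹ x) = f x) ↔
      ∀ x, f (bandStep k (n % k) n x) = f x := by
    intro f
    refine ⟨fun h x => ?_, fun h x => ?_⟩
    · rw [← hg, ← h (g x), Equiv.Perm.inv_def, Equiv.symm_apply_apply]
    · rw [← h (g⁻¹ x), ← hg, Equiv.Perm.inv_def, Equiv.apply_symm_apply]
  simp only [h2] at h1
  rw [h1]
  refine exists_congr fun L => and_congr Iff.rfl (forall_congr' fun i => ?_)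
  rw [← hg, Equiv.Perm.eq_inv_iff_eq]

/-! ### Three-block exchanges and coprimality -/

/-- The exchange of three consecutive blocks of `0, …, m - 1`, of lengths `m - u`, `u + w - m` and
`m - w`, which reverses their order. -/
def blockExchange (m u w : ℕ) (x : ZMod m) : ZMod m :=
  if x.val < m - u then x + u else if x.val < w then x + u - w else x - w

/-- A labelling of `ZMod m`, fixing `0`, in which `x ↦ x + 1` becomes `blockExchange m u w`. -/
def IsExchangeLabelling (m u w : ℕ) (L : Equiv.Perm (ZMod m)) : Prop :=
  L 0 = 0 ∧ ∀ i, L (blockExchange m u w i) = L i + 1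

section blockExchange

variable {m u w : ℕ}

theorem blockExchange_first {y : ℕ} (hy : y < m - u) :
    blockExchange m u w y = y + u := by
  rw [blockExchange, ZMod.val_cast_of_lt (by omega), if_pos hy]

theorem blockExchange_middle {y : ℕ} (hw : w < m) (hy : m - u ≤ y) (hyw : y < w) :
    blockExchange m u w y = y + u - w := by
  rw [blockExchange, ZMod.val_cast_of_lt (by omega), if_neg (by omega), if_pos hyw]

theorem blockExchange_last {y : ℕ} (huw : m ≤ u + w) (hym : y < m) (hyw : w ≤ y) :
    blockExchange m u w y = y - w := by
  rw [blockExchange, ZMod.val_cast_of_lt (by omega), if_neg (by omega), if_neg (by omega)]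

theorem blockExchange_injective (hu : u < m) (hw : w < m) (huw : m ≤ u + w) :
    Function.Injective (blockExchange m u w) := by
  have : NeZero m := ⟨by omega⟩
  have nz : ∀ a : ℕ, a ≠ 0 → a < m → (a : ZMod m) ≠ 0 := by
    intro a h0 ha h
    rw [ZMod.natCast_eq_zero_iff] at h
    exact absurd (Nat.le_of_dvd (Nat.pos_of_ne_zero h0) h) (by omega)
  have hm : (m : ZMod m) = 0 := ZMod.natCast_self m
  have key : ∀ a b : ℕ, a < m → b < m → a < b →
      blockExchange m u w a ≠ blockExchange m u w b := by
    intro a b ha hb hab h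
    have same : (a : ZMod m) ≠ b := by
      intro e
      refine nz (b - a) (by omega) (by omega) ?_
      rw [Nat.cast_sub hab.le, e, sub_self]
    rcases lt_or_ge a (m - u) with h1 | h1
    · rw [blockExchange_first h1] at h
      rcases lt_or_ge b (m - u) with h2 | h2
      · rw [blockExchange_first h2] at h
        exact same (by linear_combination h)
      rcases lt_or_ge b w with h3 | h3
      · rw [blockExchange_middle hw h2 h3] at h
        refine nz (w - (b - a)) (by omega) (by omega) ?_
        rw [Nat.cast_sub (by omega), Nat.cast_sub hab.le]
        linear_combination h
      · rw [blockExchange_last huw hb h3] at h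
        refine nz (u + w - m + (m - (b - a))) (by omega) (by omega) ?_
        rw [Nat.cast_add, Nat.cast_sub huw, Nat.cast_sub (by omega), Nat.cast_sub hab.le]
        push_cast
        linear_combination h
    rcases lt_or_ge a w with h2 | h2
    · rw [blockExchange_middle hw h1 h2] at h
      rcases lt_or_ge b w with h3 | h3
      · rw [blockExchange_middle hw (by omega) h3] at h
        exact same (by linear_combination h)
      · rw [blockExchange_last huw hb h3] at h
        refine nz (m - (u - (b - a))) (by omega) (by omega) ?_
        rw [Nat.cast_sub (by omega), Nat.cast_sub (by omega), Nat.cast_sub hab.le]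
        linear_combination hm - h
    · rw [blockExchange_last huw ha h2, blockExchange_last huw hb (by omega)] at h
      exact same (by linear_combination h)
  intro x y h
  by_contra hxy
  have hv : x.val ≠ y.val := fun e => hxy (ZMod.val_injective _ e)
  have hx := ZMod.val_lt x
  have hy := ZMod.val_lt y
  rcases lt_or_gt_of_ne hv with hlt | hlt
  · exact key x.val y.val hx hy hlt (by simpa using h)
  · exact key y.val x.val hy hx hlt (by simpa using h.symm)

/-- `blockExchange m u w` is the first-return map to {0, …, m - 1} of the rotation by u on Z/(u+w),
and that rotation is a full cycle iff u and w are coprime. -/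
theorem exists_isExchangeLabelling_iff (hu : u < m) (hw : w < m) (huw : m ≤ u + w) :
    (∃ L, IsExchangeLabelling m u w L) ↔ u.Coprime w := by
  have : NeZero m := ⟨by omega⟩
  let p : Equiv.Perm (ZMod m) := Equiv.ofBijective _
    (Finite.injective_iff_bijective.1 (blockExchange_injective hu hw huw))
  have hp : ∀ x, p x = blockExchange m u w x := fun x => rfl
  have h1 : (∃ L, IsExchangeLabelling m u w L) ↔
      ∃ L : Equiv.Perm (ZMod m), L 0 = 0 ∧ ∀ i, L (i + 1) = p (L i) := by
    constructor
    · rintro ⟨L, L0, hL⟩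
      refine ⟨L⁻¹, by rw [Equiv.Perm.inv_eq_iff_eq, L0], fun i => ?_⟩
      rw [Equiv.Perm.inv_eq_iff_eq, hp, hL, Equiv.Perm.inv_def, Equiv.apply_symm_apply]
    · rintro ⟨L, L0, hL⟩
      refine ⟨L⁻¹, by rw [Equiv.Perm.inv_eq_iff_eq, L0], fun i => ?_⟩
      rw [Equiv.Perm.inv_eq_iff_eq, hL, Equiv.Perm.inv_def, Equiv.apply_symm_apply, hp]
  rw [h1, ← transitive_iff_exists_labelling]
  simp only [hp]
  constructor
  · intro H
    set d := u.gcd w with hd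
    have hdu : d ∣ u := Nat.gcd_dvd_left _ _
    have hdw : d ∣ w := Nat.gcd_dvd_right _ _
    have hdpos : 0 < d := Nat.gcd_pos_of_pos_left _ (by omega)
    have hdle : d ≤ u := Nat.le_of_dvd (by omega) hdu
    -- The three blocks move by u, u - w and -w without wrapping around, all multiples of d, so
    -- divisibility by d is invariant; it is tested at 1.
    have := H (fun x => if d ∣ x.val then 0 else 1) (by simp) (fun x => ?_) (1 : ℕ)
    · rw [ZMod.val_cast_of_lt (by omega)] at this
      have h1 : d ∣ 1 := by
        by_contra h
        simp [h] at this
      exact Nat.dvd_one.1 h1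
    · have hx := ZMod.val_lt x
      have ex : x = (x.val : ℕ) := by simp
      generalize x.val = y at *
      subst ex
      rcases lt_or_ge y (m - u) with h1 | h1
      · rw [blockExchange_first h1, ← Nat.cast_add, ZMod.val_cast_of_lt (by omega)]
        simp only [Nat.dvd_add_left hdu]
      rcases lt_or_ge y w with h2 | h2
      · rw [blockExchange_middle hw h1 h2]
        have e : (y : ZMod m) + u - w = (y + u - w : ℕ) := by
          rw [Nat.cast_sub (by omega), Nat.cast_add]
        rw [e, ZMod.val_cast_of_lt (by omega)]
        have : d ∣ y + u - w ↔ d ∣ y := by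
          rw [← Nat.dvd_add_left hdw (b := y + u - w), Nat.sub_add_cancel (by omega),
            Nat.dvd_add_left hdu]
        simp only [this]
      · rw [blockExchange_last huw hx h2, ← Nat.cast_sub h2, ZMod.val_cast_of_lt (by omega)]
        have : d ∣ y - w ↔ d ∣ y := by
          rw [← Nat.dvd_add_left hdw (b := y - w), Nat.sub_add_cancel h2]
        simp only [this]
  · intro hc f f0 hf
    have : NeZero (u + w) := ⟨by omega⟩
    -- Extends f to a rotation-invariant function on {0, …, u + w - 1}: a point i ≥ m returns at i -
    -- w.
    let F : ℕ → ℝ := fun i => if i < m then f (i : ℕ) else f (i - w : ℕ)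
    have hF : ∀ i < u + w, F ((i + u) % (u + w)) = F i := by
      intro i hi
      rcases lt_or_ge i (m - u) with h1 | h1
      · rw [Nat.mod_eq_of_lt (by omega)]
        simp only [F]
        rw [if_pos (by omega), if_pos (by omega), ← hf (i : ℕ), blockExchange_first h1,
          Nat.cast_add]
      rcases lt_or_ge i w with h2 | h2
      · rw [Nat.mod_eq_of_lt (by omega)]
        simp only [F]
        rw [if_neg (by omega), if_pos (by omega), ← hf (i : ℕ), blockExchange_middle hw h1 h2,
          Nat.cast_sub (by omega), Nat.cast_add]
      · rw [Nat.mod_eq_sub_mod (by omega), Nat.mod_eq_of_lt (by omega)]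
        have e : i + u - (u + w) = i - w := by omega
        rw [e]
        simp only [F]
        rw [if_pos (by omega)]
        split_ifs with h3
        · rw [← hf (i : ℕ), blockExchange_last huw h3 h2, Nat.cast_sub h2]
        · rfl
    have hF' : ∀ j : ℕ, F (j * u % (u + w)) = 0 := by
      intro j
      induction j with
      | zero => simp [F, f0, show 0 < m by omega]
      | succ j ih =>
        have := hF (j * u % (u + w)) (Nat.mod_lt _ (by omega))
        rwa [Nat.mod_add_mod, ← Nat.succ_mul, ih] at this
    intro x
    have hx := ZMod.val_lt x
    have hcop : u.Coprime (u + w) := by simpa using hc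
    let c : ZMod (u + w) := (x.val : ZMod (u + w)) * (u : ZMod (u + w))⁻¹
    have hcu : ((c.val * u : ℕ) : ZMod (u + w)) = (x.val : ℕ) := by
      rw [Nat.cast_mul, ZMod.natCast_zmod_val]
      simp only [c]
      rw [mul_assoc, mul_comm _ (u : ZMod (u + w)), ZMod.coe_mul_inv_eq_one u hcop, mul_one]
    have h2 := hF' c.val
    rw [ZMod.natCast_eq_natCast_iff] at hcu
    rw [Nat.ModEq] at hcu
    rw [hcu, Nat.mod_eq_of_lt (by omega)] at h2
    simpa [F, hx] using h2

end blockExchange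

/-! ### Characterising both maps by their cuts -/

/-- `F` is a piecewise translation of `ZMod m` whose only cuts are directly after `a`, `b` and `c`,
and which reverses the cyclic order of the three blocks. -/
def ReversesBlocksAt {m : ℕ} (F : ZMod m → ZMod m) (a b c : ZMod m) : Prop :=
  F (a + 1) = F b + 1 ∧ F (b + 1) = F c + 1 ∧ F (c + 1) = F a + 1 ∧
    ∀ x, x ≠ a → x ≠ b → x ≠ c → F (x + 1) = F x + 1

theorem apply_natCast_of_translation_on {m : ℕ} {F : ZMod m → ZMod m} {a b : ℕ}
    (h : ∀ y : ℕ, a ≤ y → y < b → F ((y : ZMod m) + 1) = F y + 1) {y : ℕ} (ha : a ≤ y)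
    (hb : y ≤ b) : F y = F a + y - a := by
  induction y, ha using Nat.le_induction with
  | base => ring
  | succ y hy ih =>
    rw [Nat.cast_succ, h y hy (by omega), ih (by omega)]
    ring

theorem eq_add_apply_zero_of_translation {m : ℕ} [NeZero m] {F : ZMod m → ZMod m}
    (h : ∀ x, F (x + 1) = F x + 1) (x : ZMod m) : F x = x + F 0 := by
  have := apply_natCast_of_translation_on (a := 0) (b := x.val) (fun y _ _ => h y)
    (Nat.zero_le _) le_rfl
  rw [ZMod.natCast_zmod_val, Nat.cast_zero] at this
  rw [this]
  ring

theorem natCast_ne_natCast_of_lt {m a b : ℕ} (ha : a < m) (hb : b < m) (h : a ≠ b) :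
    (a : ZMod m) ≠ b := by
  intro e
  apply h
  rw [← ZMod.val_cast_of_lt ha, e, ZMod.val_cast_of_lt hb]

theorem bandStep_zero_left (k : ℕ) (s x : ZMod (k + 1)) : bandStep k 0 s x = x + s - 1 := by
  by_cases hx : x = 0
  · rw [hx, bandStep_zero]; ring
  · have : x.val ≠ 0 := by rwa [Ne, ZMod.val_eq_zero]
    rw [bandStep, if_neg hx, if_neg (by omega)]
    simp

theorem reversesBlocksAt_bandStep {k r : ℕ} (h0 : 0 < r) (hr : r < k) (s : ZMod (k + 1)) :
    ReversesBlocksAt (bandStep k r s) 0 (-1) r := by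
  have hk := natCast_succ_self k
  refine ⟨?_, ?_, ?_, ?_⟩
  · have h1 := bandStep_of_le s Nat.one_pos (by omega) (by omega : 1 ≤ r)
    have h2 := bandStep_of_lt s le_rfl hr
    rw [hk] at h2
    rw [zero_add, h2]
    rw [Nat.cast_one] at h1
    rw [h1]
    ring
  · rw [neg_add_cancel, bandStep_zero, bandStep_of_le s h0 hr.le le_rfl]
    ring
  · rw [bandStep_zero, ← Nat.cast_succ, bandStep_of_lt s (by omega) (by omega), Nat.cast_succ]
    ring
  · intro x hx0 hx1 hxr
    have hx := ZMod.val_lt x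
    have ex : x = (x.val : ℕ) := by simp
    generalize x.val = y at *
    subst ex
    have n0 : y ≠ 0 := by rintro rfl; simp at hx0
    have n1 : y ≠ k := by rintro rfl; exact hx1 hk
    have nr : y ≠ r := by rintro rfl; exact hxr rfl
    rw [← Nat.cast_succ]
    rcases lt_or_ge y r with h | h
    · rw [bandStep_of_le s (by omega) (by omega) (by omega),
        bandStep_of_le s (by omega) (by omega) (by omega), Nat.cast_succ]
      ring
    · rw [bandStep_of_lt s (by omega) (by omega),
        bandStep_of_lt s (by omega) (by omega), Nat.cast_succ]
      ring

/-- The blocks are {0}, {1, …, r} and {r + 1, …, k}; the relations at the cuts fix their offsets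
relative to F 0, which must be s - 1. -/
theorem eq_bandStep_of_reversesBlocksAt {k r : ℕ} (h0 : 0 < r) (hr : r < k)
    {F : ZMod (k + 1) → ZMod (k + 1)} (h : ReversesBlocksAt F 0 (-1) r) (x : ZMod (k + 1)) :
    F x = bandStep k r (F 0 + 1) x := by
  have hk := natCast_succ_self k
  obtain ⟨h1, h2, h3, h4⟩ := h
  rw [← hk] at h1 h4
  have cut : ∀ y : ℕ, y ≠ 0 → y < k → y ≠ r → F ((y : ZMod (k + 1)) + 1) = F y + 1 := by
    intro y y0 yk yr
    refine h4 _ ?_ ?_ ?_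
    · simpa using natCast_ne_natCast_of_lt (m := k + 1) (b := 0) (by omega) (by omega) y0
    · exact natCast_ne_natCast_of_lt (by omega) (by omega) yk.ne
    · exact natCast_ne_natCast_of_lt (by omega) (by omega) yr
  have last : ∀ y : ℕ, r + 1 ≤ y → y ≤ k → F y = F (r + 1 : ℕ) + y - (r + 1 : ℕ) := fun y a b =>
    apply_natCast_of_translation_on (fun y ha hb => cut y (by omega) (by omega) (by omega)) a b
  have first : ∀ y : ℕ, 1 ≤ y → y ≤ r → F y = F (1 : ℕ) + y - (1 : ℕ) := fun y a b =>
    apply_natCast_of_translation_on (fun y ha hb => cut y (by omega) (by omega) (by omega)) a b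
  rw [Nat.cast_succ, h3] at last
  rw [zero_add, last k hr le_rfl] at h1
  rw [Nat.cast_one, h1] at first
  by_cases hx0 : x = 0
  · rw [hx0, bandStep_zero]; ring
  have hv : x.val ≠ 0 := by rwa [Ne, ZMod.val_eq_zero]
  have hx := ZMod.val_lt x
  have ex : x = (x.val : ℕ) := by simp
  generalize x.val = y at *
  rw [ex]
  rcases le_or_gt y r with h | h
  · rw [bandStep_of_le _ (by omega) (by omega) h, first y (by omega) h, hk]
    ring
  · rw [bandStep_of_lt _ (by omega) h, last y (by omega) (by omega)]
    ring

theorem blockExchange_compl {m u : ℕ} [NeZero m] (hu : u ≤ m) (x : ZMod m) :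
    blockExchange m u (m - u) x = x + u := by
  rw [blockExchange]
  split_ifs
  · rfl
  · rw [Nat.cast_sub hu, ZMod.natCast_self]
    ring

theorem reversesBlocksAt_blockExchange {m u w : ℕ} (hu : u < m) (hw : w < m) (huw : m < u + w) :
    ReversesBlocksAt (blockExchange m u w) (-1) (w - 1) ((m - u : ℕ) - 1) := by
  have : NeZero m := ⟨by omega⟩
  have hm : (m : ZMod m) = 0 := ZMod.natCast_self m
  have e1 : (-1 : ZMod m) = (m - 1 : ℕ) := by
    rw [Nat.cast_sub (by omega), hm, Nat.cast_one]; ring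
  have ew : (w - 1 : ZMod m) = (w - 1 : ℕ) := by
    rw [Nat.cast_sub (by omega), Nat.cast_one]
  have eu : ((m - u : ℕ) - 1 : ZMod m) = (m - u - 1 : ℕ) := by
    rw [Nat.cast_sub (show 1 ≤ m - u by omega), Nat.cast_one]
  have h0 : blockExchange m u w (0 : ℕ) = (0 : ℕ) + u := blockExchange_first (by omega)
  have hlast : blockExchange m u w (m - 1 : ℕ) = (m - 1 : ℕ) - w :=
    blockExchange_last huw.le (by omega) (by omega)
  refine ⟨?_, ?_, ?_, ?_⟩
  · rw [neg_add_cancel, ew, blockExchange_middle hw (by omega) (by omega), ← ew,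
      ← Nat.cast_zero, h0]
    push_cast
    ring
  · rw [sub_add_cancel, eu, blockExchange_last huw.le hw le_rfl, blockExchange_first (by omega),
      ← eu, Nat.cast_sub hu.le, hm]
    ring
  · rw [sub_add_cancel, e1, hlast, ← e1, blockExchange_middle hw le_rfl (by omega),
      Nat.cast_sub hu.le, hm]
    ring
  · intro x hx1 hxw hxu
    rw [e1] at hx1
    rw [ew] at hxw
    rw [eu] at hxu
    have hx := ZMod.val_lt x
    have ex : x = (x.val : ℕ) := by simp
    generalize x.val = y at *
    subst ex
    have n1 : y ≠ m - 1 := by rintro rfl; exact hx1 rfl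
    have nw : y ≠ w - 1 := by rintro rfl; exact hxw rfl
    have nu : y ≠ m - u - 1 := by rintro rfl; exact hxu rfl
    rw [← Nat.cast_succ]
    rcases lt_or_ge y (m - u) with h1 | h1
    · rw [blockExchange_first (by omega), blockExchange_first h1]
      push_cast
      ring
    rcases lt_or_ge y w with h2 | h2
    · rw [blockExchange_middle hw (by omega) (by omega), blockExchange_middle hw h1 h2]
      push_cast
      ring
    · rw [blockExchange_last huw.le (by omega) (by omega), blockExchange_last huw.le hx h2]
      push_cast
      ring

theorem exists_eq_blockExchange_of_reversesBlocksAt {m : ℕ} {P Q : ℕ} (hP0 : 0 < P) (hP : P < m)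
    (hQ0 : 0 < Q) (hQ : Q < m) (hPQ : P ≠ Q) {F : ZMod m → ZMod m} (hF : F P = 0)
    (h : ReversesBlocksAt F (-1) (P - 1) (Q - 1)) :
    Q < P ∧ ∀ x, F x = blockExchange m (m - Q) P x := by
  have : NeZero m := ⟨by omega⟩
  have hm : (m : ZMod m) = 0 := ZMod.natCast_self m
  obtain ⟨h1, h2, h3, h4⟩ := h
  have e1 : (-1 : ZMod m) = (m - 1 : ℕ) := by
    rw [Nat.cast_sub (by omega), hm, Nat.cast_one]; ring
  have ew : (P - 1 : ZMod m) = (P - 1 : ℕ) := by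
    rw [Nat.cast_sub (by omega), Nat.cast_one]
  have eu : (Q - 1 : ZMod m) = (Q - 1 : ℕ) := by
    rw [Nat.cast_sub (by omega), Nat.cast_one]
  rw [e1, ew, eu] at h4
  rw [neg_add_cancel] at h1
  rw [sub_add_cancel, hF, eu] at h2
  rw [sub_add_cancel, e1] at h3
  have cut : ∀ y : ℕ, y < m - 1 → y ≠ P - 1 → y ≠ Q - 1 → F ((y : ZMod m) + 1) = F y + 1 := by
    intro y y0 yk yr
    refine h4 _ ?_ ?_ ?_ <;>
      exact natCast_ne_natCast_of_lt (by omega) (by omega) (by omega)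
  rcases lt_or_gt_of_ne hPQ with hlt | hlt
  -- In the order P < Q, F would be a translation from P to Q - 1, and the relation F P = F (Q - 1)
  -- + 1 would force P = Q in `ZMod m`.
  · have := apply_natCast_of_translation_on (F := F) (a := P) (b := Q - 1) (y := Q - 1)
      (fun y ha hb => cut y (by omega) (by omega) (by omega)) (by omega) le_rfl
    rw [this, hF, ← eu] at h2
    exact absurd (by linear_combination h2) (natCast_ne_natCast_of_lt hP hQ hPQ)
  · refine ⟨hlt, fun x => ?_⟩
    have last : ∀ y : ℕ, P ≤ y → y ≤ m - 1 → F y = F P + y - P := fun y a b =>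
      apply_natCast_of_translation_on (fun y ha hb => cut y (by omega) (by omega) (by omega)) a b
    have first : ∀ y : ℕ, 0 ≤ y → y ≤ Q - 1 → F y = F (0 : ℕ) + y - (0 : ℕ) := fun y a b =>
      apply_natCast_of_translation_on (fun y ha hb => cut y (by omega) (by omega) (by omega)) a b
    have middle : ∀ y : ℕ, Q ≤ y → y ≤ P - 1 → F y = F Q + y - Q := fun y a b =>
      apply_natCast_of_translation_on (fun y ha hb => cut y (by omega) (by omega) (by omega)) a b
    rw [hF] at last
    have f0 := first (Q - 1) (by omega) le_rfl
    rw [← eu] at f0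
    have l1 := last (m - 1) (by omega) le_rfl
    rw [← e1] at l1 h3
    rw [← eu] at h2
    have hx := ZMod.val_lt x
    have ex : x = (x.val : ℕ) := by simp
    generalize x.val = y at *
    subst ex
    rcases lt_or_ge y Q with c1 | c1
    · rw [blockExchange_first (by omega), first y (by omega) (by omega), Nat.cast_sub hQ.le, hm]
      linear_combination -h2 - f0
    rcases lt_or_ge y P with c2 | c2
    · rw [blockExchange_middle hP (by omega) c2, middle y c1 (by omega), Nat.cast_sub hQ.le, hm]
      linear_combination h3 + l1
    · rw [blockExchange_last (by omega) hx c2, last y c2 (by omega)]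
      ring

/-! ### Duality between the two exchanges -/

section labelling

variable {k : ℕ} (L : Equiv.Perm (ZMod (k + 1)))

theorem isBandLabelling_iff {r : ℕ} {s : ZMod (k + 1)} :
    IsBandLabelling k r s L ↔ L 0 = 0 ∧ ∀ x, bandStep k r s x = L (L.symm x - 1) := by
  refine and_congr Iff.rfl ⟨fun h x => ?_, fun h i => ?_⟩
  · rw [← h, sub_add_cancel, Equiv.apply_symm_apply]
  · rw [h, Equiv.symm_apply_apply, add_sub_cancel_right]

theorem isExchangeLabelling_iff {u w : ℕ} :
    IsExchangeLabelling (k + 1) u w L ↔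
      L 0 = 0 ∧ ∀ i, blockExchange (k + 1) u w i = L.symm (L i + 1) := by
  refine and_congr Iff.rfl (forall_congr' fun i => ?_)
  rw [Equiv.eq_symm_apply]

/-- The heart of the duality: with G the conjugate of i ↦ i - 1 and T that of x ↦ x + 1, the
relation G(x + 1) = G(y) + 1 becomes T(p + 1) = T(q) + 1 for p = L⁻¹x - 1 and q = L⁻¹y - 1. -/
theorem labelling_step_iff (x y : ZMod (k + 1)) :
    L (L.symm (x + 1) - 1) = L (L.symm y - 1) + 1 ↔
      L.symm (L (L.symm x - 1 + 1) + 1) = L.symm (L (L.symm y - 1) + 1) + 1 := by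
  rw [sub_add_cancel, Equiv.apply_symm_apply, ← Equiv.eq_symm_apply, sub_eq_iff_eq_add]

theorem reversesBlocksAt_labelling_iff (a b c : ZMod (k + 1)) :
    ReversesBlocksAt (fun x => L (L.symm x - 1)) a b c ↔
      ReversesBlocksAt (fun i => L.symm (L i + 1))
        (L.symm a - 1) (L.symm b - 1) (L.symm c - 1) := by
  have e : ∀ x y : ZMod (k + 1), x - 1 ≠ L.symm y - 1 ↔ L x ≠ y := by
    intro x y
    rw [Ne, sub_left_inj, Equiv.eq_symm_apply]
  refine and_congr (labelling_step_iff L _ _) <| and_congr (labelling_step_iff L _ _) <|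
    and_congr (labelling_step_iff L _ _) ⟨fun h x => ?_, fun h x => ?_⟩
  · have := h (L (x + 1))
    rw [labelling_step_iff, Equiv.symm_apply_apply, add_sub_cancel_right] at this
    rw [← add_sub_cancel_right x 1, e, e, e, add_sub_cancel_right]
    exact this
  · have := h (L.symm x - 1)
    rw [e, e, e, Equiv.apply_symm_apply, ← labelling_step_iff] at this
    exact this

theorem exists_isExchangeLabelling_of_isBandLabelling (hk : 0 < k) {r : ℕ} (hr : r < k)
    {s : ZMod (k + 1)} (h : IsBandLabelling k r s L) :
    ∃ u w, u ≤ k ∧ w ≤ k ∧ k + 1 ≤ u + w ∧ IsExchangeLabelling (k + 1) u w L := by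
  obtain ⟨L0, hL⟩ := (isBandLabelling_iff L).1 h
  have S0 : L.symm 0 = 0 := by rw [Equiv.symm_apply_eq, L0]
  simp only [isExchangeLabelling_iff]
  have one_ne : (1 : ZMod (k + 1)) ≠ 0 := by
    simpa using natCast_ne_natCast_of_lt (m := k + 1) (a := 1) (b := 0) (by omega) (by omega)
  rcases Nat.eq_zero_or_pos r with rfl | h0
  · have hT : ∀ i, L.symm (L (i + 1) + 1) = L.symm (L i + 1) + 1 := by
      intro i
      have := labelling_step_iff L (L (i + 1)) (L (i + 1))
      rw [Equiv.symm_apply_apply, add_sub_cancel_right] at this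
      refine this.1 ?_
      have h2 := hL (L (i + 1) + 1)
      have h3 := hL (L (i + 1))
      rw [Equiv.symm_apply_apply, add_sub_cancel_right] at h3
      rw [← h2, ← h3, bandStep_zero_left, bandStep_zero_left]
      ring
    have hT' := eq_add_apply_zero_of_translation (F := fun i => L.symm (L i + 1)) hT
    set t := L.symm (L 0 + 1) with ht
    have ht0 : t ≠ 0 := by
      rw [ht, Ne, Equiv.symm_apply_eq, L0, zero_add]
      exact one_ne
    have htv : t.val ≠ 0 := by rwa [Ne, ZMod.val_eq_zero]
    have htl := ZMod.val_lt t
    -- For r = 0 `bandStep` is a rotation, and so is its dual: an exchange with empty middle block,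
    -- u + w = k + 1.
    refine ⟨t.val, k + 1 - t.val, by omega, by omega, by omega, L0, fun i => ?_⟩
    rw [blockExchange_compl htl.le, ZMod.natCast_zmod_val]
    exact (hT' i).symm
  · have hb := reversesBlocksAt_bandStep h0 hr s
    rw [funext hL, reversesBlocksAt_labelling_iff, S0, zero_sub] at hb
    have hn1 : (-1 : ZMod (k + 1)) ≠ 0 := by rwa [Ne, neg_eq_zero]
    have hr0 : (r : ZMod (k + 1)) ≠ 0 := by
      simpa using natCast_ne_natCast_of_lt (m := k + 1) (a := r) (b := 0) (by omega) (by omega)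
        (by omega)
    have hr1 : (-1 : ZMod (k + 1)) ≠ r := by
      rw [← natCast_succ_self]
      exact natCast_ne_natCast_of_lt (by omega) (by omega) (by omega)
    have pos : ∀ x : ZMod (k + 1), x ≠ 0 → 0 < (L.symm x).val := by
      intro x hx
      refine Nat.pos_of_ne_zero fun e => hx ?_
      rwa [ZMod.val_eq_zero, Equiv.symm_apply_eq, L0] at e
    have hpq : (L.symm (-1)).val ≠ (L.symm r).val := fun e =>
      hr1 (L.symm.injective (ZMod.val_injective _ e))
    have hp := ZMod.val_lt (L.symm (-1))
    have hq := ZMod.val_lt (L.symm r)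
    have hp0 := pos _ hn1
    have hq0 := pos _ hr0
    obtain ⟨hlt, hT⟩ := exists_eq_blockExchange_of_reversesBlocksAt hp0 hp hq0 hq hpq
      (F := fun i => L.symm (L i + 1)) (by simp [S0]) (by simpa using hb)
    exact ⟨_, _, by omega, by omega, by omega, L0, fun i => (hT i).symm⟩

theorem exists_isBandLabelling_of_isExchangeLabelling {u w : ℕ} (hu : u ≤ k) (hw : w ≤ k)
    (huw : k + 1 ≤ u + w) (h : IsExchangeLabelling (k + 1) u w L) :
    ∃ r < k, ∃ s, IsBandLabelling k r s L := by
  obtain ⟨L0, hL⟩ := (isExchangeLabelling_iff L).1 h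
  have S0 : L.symm 0 = 0 := by rw [Equiv.symm_apply_eq, L0]
  simp only [isBandLabelling_iff]
  rcases huw.eq_or_lt with heq | hlt
  · obtain rfl : w = k + 1 - u := by omega
    simp only [blockExchange_compl (by omega : u ≤ k + 1)] at hL
    have hG : ∀ x, L (L.symm (x + 1) - 1) = L (L.symm x - 1) + 1 := by
      intro x
      rw [labelling_step_iff, ← hL, ← hL]
      ring
    have hG' := eq_add_apply_zero_of_translation (F := fun x => L (L.symm x - 1)) hG
    refine ⟨0, by omega, L (L.symm 0 - 1) + 1, L0, fun x => ?_⟩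
    rw [bandStep_zero_left, hG' x]
    ring
  · have hb := reversesBlocksAt_blockExchange (by omega : u < k + 1) (by omega : w < k + 1) hlt
    have hLw : L w = -1 := by
      have := hL w
      rw [blockExchange_last huw (by omega) le_rfl, sub_self, Equiv.eq_symm_apply, L0] at this
      exact eq_neg_of_add_eq_zero_left this.symm
    have e1 : (-1 : ZMod (k + 1)) = L.symm 0 - 1 := by rw [S0, zero_sub]
    have ew : (w : ZMod (k + 1)) = L.symm (-1) := by rw [← hLw, Equiv.symm_apply_apply]
    have eu : ((k + 1 - u : ℕ) : ZMod (k + 1)) = L.symm (L (k + 1 - u : ℕ)) := by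
      rw [Equiv.symm_apply_apply]
    set r := L (k + 1 - u : ℕ) with hr
    have hr0 : r ≠ 0 := by
      rw [hr, ← L0, Ne, L.injective.eq_iff]
      simpa using natCast_ne_natCast_of_lt (m := k + 1) (a := k + 1 - u) (b := 0) (by omega)
        (by omega) (by omega)
    have hr1 : r ≠ -1 := by
      rw [hr, ← hLw, Ne, L.injective.eq_iff]
      exact natCast_ne_natCast_of_lt (by omega) (by omega) (by omega)
    -- `-1` occurs both as a cut and as an argument of `L.symm`; only the cut must become `L.symm 0
    -- - 1`.
    rw [funext hL, ew, eu, e1, ← e1, ← zero_sub (1 : ZMod (k + 1))] at hb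
    nth_rewrite 1 [← S0] at hb
    rw [zero_sub, ← reversesBlocksAt_labelling_iff] at hb
    have hrv0 : r.val ≠ 0 := by rwa [Ne, ZMod.val_eq_zero]
    have hrvk : r.val ≠ k := by
      intro e
      apply hr1
      rw [← natCast_succ_self, ← ZMod.natCast_zmod_val r, e]
    have hrl := ZMod.val_lt r
    rw [← ZMod.natCast_zmod_val r] at hb
    refine ⟨r.val, by omega, L (L.symm 0 - 1) + 1, L0, fun x => ?_⟩
    exact (eq_bandStep_of_reversesBlocksAt (by omega) (by omega) hb x).symm

theorem bandStep_parameters_unique {r r' : ℕ} {s s' : ZMod (k + 1)} (hr : r < k) (hr' : r' < k)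
    (h : ∀ x, bandStep k r s x = bandStep k r' s' x) : r = r' ∧ s = s' := by
  have hs : s = s' := by simpa [bandStep_zero] using h 0
  subst hs
  refine ⟨?_, rfl⟩
  have key : ∀ r r' : ℕ, r < k → r' < k → r < r' → bandStep k r s r' ≠ bandStep k r' s r' := by
    intro r r' hr hr' hlt h
    rw [bandStep_of_lt s hr'.le hlt, bandStep_of_le s (by omega) hr'.le le_rfl] at h
    refine natCast_ne_natCast_of_lt (m := k + 1) (a := r' + 1) (b := r) (by omega) (by omega)
      (by omega) ?_
    push_cast
    linear_combination h
  rcases lt_trichotomy r r' with hlt | heq | hlt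
  · exact absurd (h _) (key _ _ hr hr' hlt)
  · exact heq
  · exact absurd (h _).symm (key _ _ hr' hr hlt)

theorem blockExchange_parameters_unique {m u u' w w' : ℕ} (hu : u < m) (hu' : u' < m)
    (hw : w < m) (hw' : w' < m) (huw : m ≤ u + w) (huw' : m ≤ u' + w')
    (h : ∀ x, blockExchange m u w x = blockExchange m u' w' x) : u = u' ∧ w = w' := by
  constructor
  · have h0 := h (0 : ℕ)
    rw [blockExchange_first (by omega), blockExchange_first (by omega)] at h0
    by_contra hne
    exact natCast_ne_natCast_of_lt hu hu' hne (by linear_combination h0)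
  · have h1 := blockExchange_last huw hw le_rfl
    have h2 := blockExchange_last huw' hw' le_rfl
    rw [sub_self] at h1 h2
    rw [← h, ← h1] at h2
    by_contra hne
    exact natCast_ne_natCast_of_lt hw' hw (Ne.symm hne) (blockExchange_injective hu hw huw h2)

theorem funext_of_apply_add_one {m : ℕ} [NeZero m] {L L' : ZMod m → ZMod m} (h0 : L 0 = L' 0)
    (h : ∀ i, L i = L' i → L (i + 1) = L' (i + 1)) : L = L' := by
  have : ∀ j : ℕ, L j = L' j := by
    intro j
    induction j with
    | zero => simpa using h0
    | succ j ih => rw [Nat.cast_succ]; exact h _ ih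
  funext x
  simpa using this x.val

theorem IsBandLabelling.unique {L} {r : ℕ} {s : ZMod (k + 1)} (hr : r < k)
    {L' : Equiv.Perm (ZMod (k + 1))} (h : IsBandLabelling k r s L)
    (h' : IsBandLabelling k r s L') : L = L' := by
  apply DFunLike.coe_injective
  refine funext_of_apply_add_one (h.1.trans h'.1.symm) fun i hi => ?_
  apply bandStep_injective hr s
  rw [h.2, h'.2, hi]

theorem IsExchangeLabelling.unique {L} {u w : ℕ} {L' : Equiv.Perm (ZMod (k + 1))}
    (h : IsExchangeLabelling (k + 1) u w L) (h' : IsExchangeLabelling (k + 1) u w L') :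
    L = L' := by
  suffices (L.symm : ZMod (k + 1) → ZMod (k + 1)) = L'.symm from
    Equiv.symm_bijective.1 (DFunLike.coe_injective this)
  refine funext_of_apply_add_one ?_ fun i hi => ?_
  · rw [(Equiv.symm_apply_eq L).2 h.1.symm, (Equiv.symm_apply_eq L').2 h'.1.symm]
  · have h1 := h.2 (L.symm i)
    have h2 := h'.2 (L'.symm i)
    rw [Equiv.apply_symm_apply] at h1 h2
    rw [(Equiv.symm_apply_eq L).2 h1.symm, (Equiv.symm_apply_eq L').2 h2.symm, hi]

end labelling

/-! ### Counting -/

open Classical in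
-- Pairs are matched when one labelling serves both. Each pair determines its labelling and the
-- labelling determines both pairs, so the matching is one-to-one.
theorem card_isBandLabelling_eq {k : ℕ} (hk : 0 < k) :
    ((Finset.range k ×ˢ (Finset.univ : Finset (ZMod (k + 1)))).filter
        fun a => ∃ L, IsBandLabelling k a.1 a.2 L).card =
      ((Finset.Icc 1 k ×ˢ Finset.Icc 1 k).filter
        fun b => k + 1 ≤ b.1 + b.2 ∧ b.1.Coprime b.2).card := by
  have hex : ∀ b : ℕ × ℕ, b ∈ ((Finset.Icc 1 k ×ˢ Finset.Icc 1 k).filter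
      fun b => k + 1 ≤ b.1 + b.2 ∧ b.1.Coprime b.2) ↔ b.1 ≤ k ∧ b.2 ≤ k ∧ k + 1 ≤ b.1 + b.2 ∧
        ∃ L, IsExchangeLabelling (k + 1) b.1 b.2 L := by
    rintro ⟨u, w⟩
    simp only [Finset.mem_filter, Finset.mem_product, Finset.mem_Icc]
    constructor
    · rintro ⟨⟨⟨_, h1⟩, _, h2⟩, h3, h4⟩
      exact ⟨h1, h2, h3, (exists_isExchangeLabelling_iff (by omega) (by omega) h3).2 h4⟩
    · rintro ⟨h1, h2, h3, h4⟩
      exact ⟨⟨⟨by omega, h1⟩, by omega, h2⟩, h3,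
        (exists_isExchangeLabelling_iff (by omega) (by omega) h3).1 h4⟩
  apply le_antisymm
  · refine Finset.card_le_card_of_forall_subsingleton
      (fun a b => ∃ L, IsBandLabelling k a.1 a.2 L ∧ IsExchangeLabelling (k + 1) b.1 b.2 L) ?_ ?_
    · rintro ⟨r, s⟩ ha
      simp only [Finset.mem_filter, Finset.mem_product, Finset.mem_range] at ha
      obtain ⟨⟨hr, -⟩, L, hL⟩ := ha
      obtain ⟨u, w, h1, h2, h3, h4⟩ := exists_isExchangeLabelling_of_isBandLabelling L hk hr hL
      exact ⟨(u, w), (hex _).2 ⟨h1, h2, h3, L, h4⟩, L, hL, h4⟩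
    · rintro ⟨u, w⟩ hb ⟨r, s⟩ ⟨ha, L, hL1, hL2⟩ ⟨r', s'⟩ ⟨ha', L', hL1', hL2'⟩
      obtain rfl := hL2.unique hL2'
      simp only [Finset.mem_filter, Finset.mem_product, Finset.mem_range] at ha ha'
      obtain ⟨e1, e2⟩ := bandStep_parameters_unique ha.1.1 ha'.1.1 fun x => by
        rw [((isBandLabelling_iff L).1 hL1).2, ((isBandLabelling_iff L).1 hL1').2]
      exact Prod.ext e1 e2
  · refine Finset.card_le_card_of_forall_subsingleton
      (fun b a => ∃ L, IsBandLabelling k a.1 a.2 L ∧ IsExchangeLabelling (k + 1) b.1 b.2 L) ?_ ?_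
    · rintro ⟨u, w⟩ hb
      obtain ⟨h1, h2, h3, L, h4⟩ := (hex _).1 hb
      obtain ⟨r, hr, s, hL⟩ := exists_isBandLabelling_of_isExchangeLabelling L h1 h2 h3 h4
      refine ⟨(r, s), ?_, L, hL, h4⟩
      simp only [Finset.mem_filter, Finset.mem_product, Finset.mem_range, Finset.mem_univ]
      exact ⟨⟨hr, trivial⟩, L, hL⟩
    · rintro ⟨r, s⟩ ha ⟨u, w⟩ ⟨hb, L, hL1, hL2⟩ ⟨u', w'⟩ ⟨hb', L', hL1', hL2'⟩
      simp only [Finset.mem_filter, Finset.mem_product, Finset.mem_range] at ha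
      obtain rfl := hL1.unique ha.1.1 hL1'
      obtain ⟨h1, h2, h3, -⟩ := (hex _).1 hb
      obtain ⟨h1', h2', h3', -⟩ := (hex _).1 hb'
      simp only at h1 h2 h3 h1' h2' h3'
      obtain ⟨e1, e2⟩ := blockExchange_parameters_unique (by omega : u < k + 1)
        (by omega : u' < k + 1) (by omega : w < k + 1) (by omega : w' < k + 1) h3 h3' fun x => by
          rw [((isExchangeLabelling_iff L).1 hL2).2, ((isExchangeLabelling_iff L).1 hL2').2]
      exact Prod.ext e1 e2

theorem card_det_skewBandMatrix_ne_zero {k : ℕ} (hk : 0 < k) :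
    ((Finset.range (k ^ 2 + k)).filter fun n => (skewBandMatrix n k).det ≠ 0).card =
      ((Finset.Icc 1 k ×ˢ Finset.Icc 1 k).filter
        fun b => k + 1 ≤ b.1 + b.2 ∧ b.1.Coprime b.2).card := by
  classical
  have hcop : k.Coprime (k + 1) := by simp
  have hmul : k ^ 2 + k = k * (k + 1) := by ring
  rw [← card_isBandLabelling_eq hk]
  refine Finset.card_bij (fun n _ => (n % k, (n : ZMod (k + 1)))) ?_ ?_ ?_
  · intro n hn
    simp only [Finset.mem_filter, Finset.mem_range,
      det_skewBandMatrix_ne_zero_iff_exists_labelling n hk] at hn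
    simp only [Finset.mem_filter, Finset.mem_product, Finset.mem_range, Finset.mem_univ]
    exact ⟨⟨Nat.mod_lt _ hk, trivial⟩, hn.2⟩
  · intro n hn n' hn' h
    simp only [Finset.mem_filter, Finset.mem_range, hmul] at hn hn'
    obtain ⟨h1, h2⟩ := Prod.mk.inj h
    rw [ZMod.natCast_eq_natCast_iff] at h2
    have := (Nat.modEq_and_modEq_iff_modEq_mul hcop).1 ⟨h1, h2⟩
    exact this.eq_of_lt_of_lt hn.1 hn'.1
  · rintro ⟨r, s⟩ ha
    simp only [Finset.mem_filter, Finset.mem_product, Finset.mem_range, Finset.mem_univ] at ha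
    obtain ⟨⟨hr, -⟩, hL⟩ := ha
    let c := Nat.chineseRemainder hcop r s.val
    have h1 : (c : ℕ) % k = r := by
      have := c.2.1
      rwa [Nat.ModEq, Nat.mod_eq_of_lt hr] at this
    have h2 : ((c : ℕ) : ZMod (k + 1)) = s := by
      have := c.2.2
      rw [← ZMod.natCast_eq_natCast_iff] at this
      simpa using this
    refine ⟨c, ?_, Prod.ext h1 h2⟩
    simp only [Finset.mem_filter, Finset.mem_range,
      det_skewBandMatrix_ne_zero_iff_exists_labelling _ hk]
    refine ⟨?_, ?_⟩
    · rw [hmul]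
      exact Nat.chineseRemainder_lt_mul hcop _ _ hk.ne' (by omega)
    · rw [h1, h2]
      exact hL

/-- For the step to k + 1, take the coprime pairs in [1, k+1]² with sum at least k + 1. Dropping
those of sum k + 1 (φ(k+1) of them) leaves the new set; dropping those with an entry k + 1 (2φ(k+1)
of them) leaves the old one. -/
theorem card_coprime_pairs_eq_sum_totient {k : ℕ} (hk : 0 < k) :
    ((Finset.Icc 1 k ×ˢ Finset.Icc 1 k).filter
        fun b => k + 1 ≤ b.1 + b.2 ∧ b.1.Coprime b.2).card =
      ∑ n ∈ Finset.Ioc 0 k, n.totient := by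
  induction k, hk using Nat.le_induction with
  | base => decide
  | succ k hk ih =>
    have hk : 1 ≤ k := hk
    rw [Finset.sum_Ioc_succ_top (Nat.zero_le k), ← ih]
    set E := (Finset.Icc 1 (k + 1) ×ˢ Finset.Icc 1 (k + 1)).filter
        fun b => k + 1 ≤ b.1 + b.2 ∧ b.1.Coprime b.2 with hE
    have self : ¬ (k + 1).Coprime (k + 1) := by
      rw [Nat.coprime_self]; omega
    have pos : ∀ a, (k + 1).Coprime a → a ≠ 0 := by
      rintro a h rfl
      rw [Nat.coprime_zero_right] at h
      omega
    have c1 : (E.filter fun b => b.1 + b.2 = k + 1).card = (k + 1).totient := by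
      rw [Nat.totient_eq_card_coprime]
      refine Finset.card_bij' (fun b _ => b.1) (fun a _ => (a, k + 1 - a)) ?_ ?_ ?_ ?_
      · rintro ⟨u, w⟩ hb
        simp only [hE, Finset.mem_filter, Finset.mem_product, Finset.mem_Icc, Finset.mem_range] at hb ⊢
        refine ⟨by omega, ?_⟩
        rw [← hb.2, Nat.coprime_self_add_left]
        exact hb.1.2.2.symm
      · intro a ha
        simp only [hE, Finset.mem_filter, Finset.mem_product, Finset.mem_Icc, Finset.mem_range] at ha ⊢
        have := pos a ha.2
        refine ⟨⟨⟨by omega, by omega⟩, by omega, ?_⟩, by omega⟩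
        rw [Nat.coprime_sub_self_right (by omega)]
        exact ha.2.symm
      · rintro ⟨u, w⟩ hb
        simp only [hE, Finset.mem_filter, Finset.mem_product, Finset.mem_Icc] at hb ⊢
        exact Prod.ext rfl (by simp only; omega)
      · intro a _; rfl
    have c2 : (E.filter fun b => b.1 = k + 1).card = (k + 1).totient := by
      rw [Nat.totient_eq_card_coprime]
      refine Finset.card_bij' (fun b _ => b.2) (fun a _ => (k + 1, a)) ?_ ?_ ?_ ?_
      · rintro ⟨u, w⟩ hb
        simp only [hE, Finset.mem_filter, Finset.mem_product, Finset.mem_Icc, Finset.mem_range] at hb ⊢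
        obtain ⟨⟨h1, -, h2⟩, rfl⟩ := hb
        refine ⟨lt_of_le_of_ne h1.2.2 ?_, h2⟩
        rintro rfl
        exact self h2
      · intro a ha
        simp only [hE, Finset.mem_filter, Finset.mem_product, Finset.mem_Icc, Finset.mem_range] at ha ⊢
        have := pos a ha.2
        exact ⟨⟨⟨by omega, by omega⟩, by omega, ha.2⟩, trivial⟩
      · rintro ⟨u, w⟩ hb
        simp only [Finset.mem_filter] at hb ⊢
        exact Prod.ext hb.2.symm rfl
      · intro a _; rfl
    have c3 : (E.filter fun b => b.2 = k + 1).card = (k + 1).totient := by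
      rw [← c2]
      refine Finset.card_bij' (fun b _ => b.swap) (fun b _ => b.swap) ?_ ?_
        (fun _ _ => rfl) (fun _ _ => rfl) <;>
      · rintro ⟨u, w⟩ hb
        simp only [hE, Finset.mem_filter, Finset.mem_product, Finset.mem_Icc, Prod.fst_swap,
          Prod.snd_swap] at hb ⊢
        exact ⟨⟨⟨by omega, by omega⟩, by omega, hb.1.2.2.symm⟩, hb.2⟩
    have e1 := Finset.card_filter_add_card_filter_not (s := E) fun b => b.1 + b.2 = k + 1
    have e2 := Finset.card_filter_add_card_filter_not (s := E) fun b => b.1 = k + 1 ∨ b.2 = k + 1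
    have e3 : (E.filter fun b => b.1 = k + 1 ∨ b.2 = k + 1).card =
        (k + 1).totient + (k + 1).totient := by
      rw [Finset.filter_or, Finset.card_union_of_disjoint, c2, c3]
      rw [Finset.disjoint_left]
      rintro ⟨u, w⟩ h1 h2
      simp only [hE, Finset.mem_filter] at h1 h2
      obtain ⟨⟨-, -, h⟩, rfl⟩ := h1
      rw [h2.2] at h
      exact self h
    have e4 : (E.filter fun b => ¬ b.1 + b.2 = k + 1) =
        (Finset.Icc 1 (k + 1) ×ˢ Finset.Icc 1 (k + 1)).filter
          fun b => k + 1 + 1 ≤ b.1 + b.2 ∧ b.1.Coprime b.2 := by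
      ext ⟨u, w⟩
      simp only [hE, Finset.mem_filter, Finset.mem_product, Finset.mem_Icc]
      constructor
      · rintro ⟨⟨h1, h2, h3⟩, h4⟩
        exact ⟨h1, by omega, h3⟩
      · rintro ⟨h1, h2, h3⟩
        exact ⟨⟨h1, by omega, h3⟩, by omega⟩
    have e5 : (E.filter fun b => ¬ (b.1 = k + 1 ∨ b.2 = k + 1)) =
        (Finset.Icc 1 k ×ˢ Finset.Icc 1 k).filter
          fun b => k + 1 ≤ b.1 + b.2 ∧ b.1.Coprime b.2 := by
      ext ⟨u, w⟩
      simp only [hE, Finset.mem_filter, Finset.mem_product, Finset.mem_Icc]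
      constructor
      · rintro ⟨⟨h1, h2, h3⟩, h4⟩
        exact ⟨by omega, h2, h3⟩
      · rintro ⟨h1, h2, h3⟩
        exact ⟨⟨by omega, h2, h3⟩, by omega⟩
    rw [e4, c1] at e1
    rw [e5, e3] at e2
    omega

/-! ### Asymptotics of the totient sum -/

open ArithmeticFunction in
theorem tsum_moebius_div_sq : ∑' n : ℕ, (moebius n : ℝ) / (n : ℝ) ^ 2 = 6 / Real.pi ^ 2 := by
  have h := LSeries_zeta_mul_Lseries_moebius (s := 2) (by norm_num)
  rw [LSeries_zeta_eq_riemannZeta (by norm_num), riemannZeta_two] at h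
  have e : LSeries (fun n => (moebius n : ℂ)) 2 =
      ((∑' n : ℕ, (moebius n : ℝ) / (n : ℝ) ^ 2 : ℝ) : ℂ) := by
    rw [LSeries, Complex.ofReal_tsum]
    refine tsum_congr fun n => ?_
    rcases eq_or_ne n 0 with rfl | hn
    · simp
    · rw [LSeries.term_of_ne_zero hn]
      push_cast
      norm_cast
  rw [e] at h
  have h' : Real.pi ^ 2 / 6 * ∑' n : ℕ, (moebius n : ℝ) / (n : ℝ) ^ 2 = 1 := by exact_mod_cast h
  have hpi := Real.pi_ne_zero
  field_simp
  linear_combination 6 * h'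

open ArithmeticFunction in
-- φ is the Dirichlet convolution of μ with the identity, and the inner sums are triangular numbers.
theorem sum_totient_eq_sum_moebius (k : ℕ) :
    (∑ n ∈ Finset.Ioc 0 k, (n.totient : ℝ)) =
      ∑ d ∈ Finset.Ioc 0 k, (moebius d : ℝ) * (((k / d : ℕ) : ℝ) * ((k / d : ℕ) + 1) / 2) := by
  let f : ArithmeticFunction ℝ := ((moebius : ArithmeticFunction ℤ) : ArithmeticFunction ℝ)
  let g : ArithmeticFunction ℝ := ⟨fun n => (n : ℝ), by simp⟩
  have h := sum_Ioc_mul_eq_sum_sum f g k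
  have gauss : ∀ q : ℕ, ∑ m ∈ Finset.Ioc 0 q, g m = (q : ℝ) * (q + 1) / 2 := by
    intro q
    induction q with
    | zero => simp
    | succ q ih =>
      rw [Finset.sum_Ioc_succ_top (Nat.zero_le q), ih]
      simp only [g, ArithmeticFunction.coe_mk]
      push_cast
      ring
  simp only [gauss] at h
  have hphi : ∀ n ∈ Finset.Ioc 0 k, (n.totient : ℝ) = (f * g) n := by
    intro n hn
    have := (sum_eq_iff_sum_mul_moebius_eq (R := ℝ) (f := fun n => (n.totient : ℝ))
      (g := fun n => (n : ℝ))).1 (fun n _ => by exact_mod_cast n.sum_totient) n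
      (Finset.mem_Ioc.1 hn).1
    rw [← this, ArithmeticFunction.mul_apply]
    rfl
  rw [Finset.sum_congr rfl hphi, h]
  rfl

theorem tendsto_natDiv_div (d : ℕ) :
    Filter.Tendsto (fun k : ℕ => ((k / d : ℕ) : ℝ) / k) Filter.atTop (nhds (1 / d)) := by
  have h := (tendsto_nat_floor_mul_div_atTop (R := ℝ) (a := 1 / d) (by positivity)).comp
    tendsto_natCast_atTop_atTop
  refine h.congr fun k => ?_
  rw [Function.comp, one_div_mul_eq_div, Nat.floor_div_eq_div]

open ArithmeticFunction in
theorem tendsto_sum_totient_div :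
    Filter.Tendsto (fun k : ℕ => (∑ n ∈ Finset.Ioc 0 k, (n.totient : ℝ)) / ((k : ℝ) ^ 2 + k))
      Filter.atTop (nhds (3 / Real.pi ^ 2)) := by
  have hlim : 3 / Real.pi ^ 2 = ∑' d : ℕ, (moebius d : ℝ) * ((1 / d) * (1 / d) / 2) := by
    have : ∀ d : ℕ, (moebius d : ℝ) * ((1 / d) * (1 / d) / 2) =
        (moebius d : ℝ) / (d : ℝ) ^ 2 * (1 / 2) := by
      intro d
      ring
    simp only [this]
    rw [tsum_mul_right, tsum_moebius_div_sq]
    ring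
  have hsum : ∀ k : ℕ, (∑ n ∈ Finset.Ioc 0 k, (n.totient : ℝ)) / ((k : ℝ) ^ 2 + k) =
      ∑' d : ℕ, (moebius d : ℝ) *
        (((k / d : ℕ) : ℝ) * ((k / d : ℕ) + 1) / 2 / ((k : ℝ) ^ 2 + k)) := by
    intro k
    rw [sum_totient_eq_sum_moebius, Finset.sum_div, tsum_eq_sum (s := Finset.Ioc 0 k)]
    · exact Finset.sum_congr rfl fun d _ => by ring
    · intro d hd
      rcases Nat.eq_zero_or_pos d with rfl | h0
      · simp
      · have : k / d = 0 := Nat.div_eq_of_lt (by simp at hd; omega)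
        simp [this]
  rw [hlim, funext hsum]
  -- Writing q for ⌊k/d⌋, either q = 0 or q(q + 1)/2 ≤ q² ≤ k²/d², which gives the bound 1/d².
  refine tendsto_tsum_of_dominated_convergence (bound := fun d : ℕ => 1 / (d : ℝ) ^ 2)
    (Real.summable_one_div_nat_pow.2 (by norm_num)) (fun d => ?_)
    (Filter.Eventually.of_forall fun k d => ?_)
  · refine Filter.Tendsto.const_mul _ ?_
    have h1 := tendsto_natDiv_div d
    have h2 := tendsto_one_div_atTop_nhds_zero_nat (𝕜 := ℝ)
    have h3 := ((h1.mul (h1.add h2)).div_const 2).div (h2.const_add 1) (by norm_num)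
    simp only [add_zero, div_one] at h3
    refine h3.congr' ?_
    filter_upwards [Filter.eventually_gt_atTop 0] with k hk
    have : (k : ℝ) ≠ 0 := by positivity
    simp only [Pi.div_apply]
    field_simp
  · have hmu : |(moebius d : ℝ)| ≤ 1 := by exact_mod_cast abs_moebius_le_one
    rw [Real.norm_eq_abs, abs_mul]
    set q : ℝ := ((k / d : ℕ) : ℝ) with hq
    have hq0 : 0 ≤ q := by positivity
    have hnn : 0 ≤ q * (q + 1) / 2 / ((k : ℝ) ^ 2 + k) := by positivity
    rw [abs_of_nonneg hnn]
    refine (mul_le_of_le_one_left hnn hmu).trans ?_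
    rcases Nat.eq_zero_or_pos (k / d) with h0 | h0
    · rw [hq, h0]
      simp
    · have hd : 0 < d := Nat.pos_of_ne_zero (by rintro rfl; simp at h0)
      have hk : 0 < k := Nat.pos_of_ne_zero (by rintro rfl; simp at h0)
      have hdR : (0 : ℝ) < d := by exact_mod_cast hd
      have hkR : (0 : ℝ) < k := by exact_mod_cast hk
      have hq1 : 1 ≤ q := by rw [hq]; exact_mod_cast h0
      have hqk : q * d ≤ k := by rw [hq]; exact_mod_cast Nat.div_mul_le_self k d
      rw [div_le_div_iff₀ (by positivity) (by positivity)]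
      have h1 : q * (q + 1) / 2 ≤ q ^ 2 := by nlinarith
      have h2 : (q * d) ^ 2 ≤ (k : ℝ) ^ 2 := by gcongr
      have h3 : q * (q + 1) / 2 * (d : ℝ) ^ 2 ≤ q ^ 2 * (d : ℝ) ^ 2 := by gcongr
      nlinarith

theorem nonsingularProportion_eq {k : ℕ} (hk : 0 < k) :
    nonsingularProportion k =
      (∑ n ∈ Finset.Ioc 0 k, (n.totient : ℝ)) / ((k : ℝ) ^ 2 + k) := by
  rw [nonsingularProportion, card_det_skewBandMatrix_ne_zero hk,
    card_coprime_pairs_eq_sum_totient hk, Nat.cast_sum]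

theorem theorem8p1 :
    Filter.Tendsto nonsingularProportion Filter.atTop (nhds (3 / Real.pi ^ 2)) ∧
      |3 / Real.pi ^ 2 - 0.304| < 0.0005 := by
  constructor
  · refine tendsto_sum_totient_div.congr' ?_
    filter_upwards [Filter.eventually_gt_atTop 0] with k hk
    exact (nonsingularProportion_eq hk).symm
  · have h1 := Real.pi_gt_d4
    have h2 := Real.pi_lt_d4
    have h3 : (3.1415 : ℝ) ^ 2 < Real.pi ^ 2 := by gcongr
    have h4 : Real.pi ^ 2 < (3.1416 : ℝ) ^ 2 := by gcongr
    have hpos : 0 < Real.pi ^ 2 := by positivity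
    rw [abs_lt]
    constructor
    · rw [lt_sub_iff_add_lt, lt_div_iff₀ hpos]
      nlinarith
    · rw [sub_lt_iff_lt_add, div_lt_iff₀ hpos]
      nlinarith
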